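/- Let $\mathbb{P}$ be the set of prime numbers and let $$\mathcal{A} = \Big(\prod_{p\in\mathbb{P}} \mathbb{F}_p\Big)\Big/\Big(\bigoplus_{p\in\mathbb{P}} \mathbb{F}_p\Big).$$ A field is called quasi-finite if it is perfect and its absolute Galois group is isomorphic, as a topological group, to $\hat{\mathbb{Z}} = \varprojlim_n \mathbb{Z}/n\mathbb{Z}$. For an ultrafilter $\mathcal{U}$ on $\mathbb{P}$, the ring of non-standard integers $\lim_{p\to\mathcal{U}}\mathbb{Z}$ is the ultrapower of $\mathbb{Z}$ along $\mathcal{U}$, i.e. the quotient of $\mathbb{Z}^{\mathbb{P}}$ by equality on a set belonging to $\mathcal{U}$. **Proposition.** Let $m \in \operatorname{Spec}(\mathcal{A})$ be any prime ideal. Then: 1. $m$ is a maximal ideal, and the field $\mathcal{A}/m$ is quasi-finite. 2. There is a unique non-principal ultrafilter $\mathcal{U}$ on $\mathbb{P}$ such that, for every $f \in \prod_p \mathbb{F}_p$, the class of $f$ in $\mathcal{A}$ lies in $m$ if and only if $\{p : f(p) = 0\} \in \mathcal{U}$. The multiplicative group $(\mathcal{A}/m)^\times$ is naturally a module over the non-standard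 integers $\lim_{p\to\mathcal{U}}\mathbb{Z}$: there is a unique module structure (with the group written additively) for which the class of $(n(p))_p \in \mathbb{Z}^{\mathbb{P}}$ sends the class of $(f(p))_p \in \prod_p \mathbb{F}_p^\times$ to the class of $(f(p)^{n(p)})_p$. 3. $(\mathcal{A}/m)^\times / ((\mathcal{A}/m)^\times)^2 \cong \mathbb{Z}/2\mathbb{Z}$. 4. $\mathcal{A}/m$ is isomorphic to a subfield of $\mathbb{C}$. -/

import Mathlib

namespace FieldBoundary

/-- The ideal `⨁_p 𝔽_p` of the product ring `∏_p 𝔽_p` (`p` running over all primes): the families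
with only finitely many nonzero entries. -/
def directSumIdeal : Ideal (∀ p : Nat.Primes, ZMod p) where
  carrier := {f | {p | f p ≠ 0}.Finite}
  zero_mem' := by simp
  add_mem' := by
    intro f g hf hg
    refine Set.Finite.subset (Set.Finite.union hf hg) ?_
    intro p hp
    by_contra h
    simp only [Set.mem_union, Set.mem_ofPred_eq, not_or, not_not] at h
    exact hp (by simp [h.1, h.2])
  smul_mem' := by
    intro c f hf
    refine Set.Finite.subset hf ?_
    intro p hp h
    exact hp (by simp [h])

/-- The ring `𝒜 = ∏_p 𝔽_p / ⨁_p 𝔽_p`. -/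
def A : Type := (∀ p : Nat.Primes, ZMod p) ⧸ directSumIdeal

instance : CommRing A :=
  inferInstanceAs (CommRing ((∀ p : Nat.Primes, ZMod p) ⧸ directSumIdeal))

/-- The class in `𝒜` of a family `(f p)_p`. -/
def toA : (∀ p : Nat.Primes, ZMod p) →+* A := Ideal.Quotient.mk directSumIdeal

/-- The additive group `Ẑ = lim_n ℤ/nℤ`, as the subgroup of compatible families in
`∏_{n ≥ 1} ℤ/nℤ`; it carries the subspace topology of the product of the discrete groups. -/
def ZHat : AddSubgroup (∀ n : ℕ+, ZMod n) where
  carrier := {x | ∀ (m n : ℕ+) (h : (m : ℕ) ∣ (n : ℕ)), ZMod.castHom h (ZMod m) (x n) = x m}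
  zero_mem' := by
    intro m n h
    exact map_zero _
  add_mem' := by
    intro x y hx hy m n h
    rw [Pi.add_apply, map_add, hx m n h, hy m n h, Pi.add_apply]
  neg_mem' := by
    intro x hx m n h
    rw [Pi.neg_apply, map_neg, hx m n h, Pi.neg_apply]

/-- A field is quasi-finite if it is perfect and its absolute Galois group (with the Krull
topology) is isomorphic to `Ẑ` as a topological group. -/
def IsQuasiFinite (K : Type*) [Field K] : Prop :=
  PerfectField K ∧ Nonempty (Field.absoluteGaloisGroup K ≃ₜ* Multiplicative ZHat)

/-- The ultrafilter `U` on the set of primes is non-principal and `m` is the set of all classes of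
families `f` with `lim_{p → U} f p = 0`, that is, with `f p = 0` for `U`-almost all `p`. -/
def Corresponds (m : Ideal A) (U : Ultrafilter Nat.Primes) : Prop :=
  (∀ p : Nat.Primes, U ≠ pure p) ∧
    ∀ f : ∀ p : Nat.Primes, ZMod p, toA f ∈ m ↔ ∀ᶠ p in (U : Filter Nat.Primes), f p = 0

/-- The ring of non-standard integers `lim_{p → U} ℤ`, the ultrapower of `ℤ` along `U`. -/
abbrev NonstandardInt (U : Ultrafilter Nat.Primes) : Type := (U : Filter Nat.Primes).Germ ℤ

/-- The class in `(𝒜/m)ˣ` of a family of units `f p ∈ 𝔽_pˣ`. -/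
def unitClass (m : Ideal A) (f : ∀ p : Nat.Primes, (ZMod p)ˣ) : (A ⧸ m)ˣ :=
  Units.map ((Ideal.Quotient.mk m).comp toA : (∀ p : Nat.Primes, ZMod p) →* A ⧸ m)
    (MulEquiv.piUnits.symm f)

/-- A module structure over the non-standard integers on the group `(𝒜/m)ˣ` (written additively) is
the natural one if it is entrywise exponentiation: the class of `(n p)_p` acts on the class of
`(f p)_p` by giving the class of `(f p ^ n p)_p`. -/
def IsNaturalModule (m : Ideal A) (U : Ultrafilter Nat.Primes)
    (M : Module (NonstandardInt U) (Additive (A ⧸ m)ˣ)) : Prop :=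
  ∀ (n : Nat.Primes → ℤ) (f : ∀ p : Nat.Primes, (ZMod p)ˣ),
    M.toSMul.smul (n : NonstandardInt U) (Additive.ofMul (unitClass m f)) =
      Additive.ofMul (unitClass m fun p => f p ^ n p)

end FieldBoundary

/-!
A prime ideal `m` of `𝒜` is governed by zero sets: `m` contains the class of `f` as soon as it
contains the class of some family whose zeros are among those of `f`. The zero sets of the members
of `m` form an ultrafilter `U` (`zeroUltrafilter`), non-principal because `m` contains the class
of every finitely supported family. Hence `𝒜/m` is the ultraproduct of the fields `𝔽_p` along `U`.
It is a field of characteristic zero, and statements about its units are checked entrywise,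
`U`-almost everywhere; this gives the module structure over the non-standard integers and the
index of the squares.

For the Galois group, `𝒜/m` is embedded in the ultraproduct `Ω` of the fields `𝔽̄_p`, which is
algebraically closed (`isAlgClosed_ultraproduct`). The ultraproduct `φ` of the Frobenius maps acts
on `Ω` with fixed field `𝒜/m`, and roots of unity of order `p ^ n - 1` make up a point of `Ω` of
exact `φ`-period `n`. A point with finite `φ`-orbit is algebraic over the fixed field
(`isAlgebraic_of_iterate_fixed`), so these points lie in the algebraic closure of `𝒜/m`, and `φ`
restricts to it. Since its fixed field is the base field, `φ` generates a dense subgroup of the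
absolute Galois group (`dense_zpowers_of_fixed`). An automorphism therefore acts on a point of
period `n` as a power of `φ` whose exponent is well defined modulo `n`, and these exponents give
the isomorphism with `Ẑ` (`nonempty_gal_continuousMulEquiv_zHat`).

Finally `𝒜/m` has at most the cardinality of the continuum, and every field of characteristic zero
of at most that size embeds in `ℂ` (`exists_ringHom_complex`).
-/

namespace FieldBoundary

/-! ### Groups topologically generated by one element -/

/-- The characters `χ n` are the components of the isomorphism, and compatible because they are so
on the powers of `φ`. Surjectivity is a compactness argument: for `x ∈ Ẑ` the closed sets `{g | χ
n g = x n}` are nonempty, because they contain a power of `φ`, and decrease along divisibility. -/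
theorem nonempty_continuousMulEquiv_zHat {G : Type*} [Group G] [TopologicalSpace G]
    [CompactSpace G] (φ : G) (hφ : Dense (Subgroup.zpowers φ : Set G))
    (χ : ∀ n : ℕ+, G →* Multiplicative (ZMod n)) (hχ : ∀ n, Continuous (χ n))
    (hχφ : ∀ n, χ n φ = Multiplicative.ofAdd 1) (hinj : ∀ g, (∀ n, χ n g = 1) → g = 1) :
    Nonempty (G ≃ₜ* Multiplicative ZHat) := by
  have hχz (n : ℕ+) (k : ℤ) : (χ n (φ ^ k)).toAdd = k := by
    simp [map_zpow, hχφ]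
  have compat (g : G) : (fun n => (χ n g).toAdd) ∈ ZHat := by
    intro m n h
    have hcl : IsClosed {g : G | ZMod.castHom h (ZMod m) (χ n g).toAdd = (χ m g).toAdd} :=
      isClosed_eq ((continuous_of_discreteTopology).comp
        (continuous_toAdd.comp (hχ n))) (continuous_toAdd.comp (hχ m))
    have hsub : (Subgroup.zpowers φ : Set G) ⊆
        {g : G | ZMod.castHom h (ZMod m) (χ n g).toAdd = (χ m g).toAdd} := by
      rintro _ ⟨k, rfl⟩
      simp only [Set.mem_ofPred_eq, hχz, map_intCast]
    exact hcl.closure_subset_iff.2 hsub (hφ g)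
  let Φ : G →* Multiplicative ZHat :=
    { toFun := fun g => Multiplicative.ofAdd ⟨fun n => (χ n g).toAdd, compat g⟩
      map_one' := by
        apply Multiplicative.toAdd.injective
        ext n
        simp
      map_mul' := fun a b => by
        apply Multiplicative.toAdd.injective
        ext n
        simp }
  have hcont : Continuous Φ := by
    refine continuous_ofAdd.comp ((continuous_pi fun n => ?_).subtype_mk _)
    exact continuous_toAdd.comp (hχ n)
  have hinjΦ : Function.Injective Φ := by
    rw [injective_iff_map_eq_one]
    intro g hg
    refine hinj g fun n => ?_
    exact congrArg (fun y : Multiplicative ZHat => Multiplicative.ofAdd (y.toAdd.1 n)) hg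
  have hsurj : Function.Surjective Φ := by
    intro y
    let x : ZHat := y.toAdd
    have hcl (n : ℕ+) : IsClosed {g : G | (χ n g).toAdd = x.1 n} :=
      isClosed_eq (continuous_toAdd.comp (hχ n)) continuous_const
    have hmono (m n : ℕ+) (h : (m : ℕ) ∣ n) :
        {g : G | (χ n g).toAdd = x.1 n} ⊆ {g : G | (χ m g).toAdd = x.1 m} := by
      intro g hg
      have h1 := compat g m n h
      have h2 := x.2 m n h
      simp only [Set.mem_ofPred_eq] at hg ⊢
      exact h1.symm.trans ((congrArg _ hg).trans h2)
    have hne (n : ℕ+) : {g : G | (χ n g).toAdd = x.1 n}.Nonempty := by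
      obtain ⟨k, hk⟩ := ZMod.intCast_surjective (x.1 n)
      exact ⟨φ ^ k, by simp only [Set.mem_ofPred_eq, hχz, hk]⟩
    obtain ⟨g, hg⟩ := IsCompact.nonempty_iInter_of_directed_nonempty_isCompact_isClosed
      (fun n : ℕ+ => {g : G | (χ n g).toAdd = x.1 n})
      (fun a b => ⟨a * b, hmono a (a * b) (by simp), hmono b (a * b) (by simp)⟩)
      hne (fun n => (hcl n).isCompact) hcl
    refine ⟨g, Multiplicative.toAdd.injective (Subtype.ext (funext fun n => ?_))⟩
    exact Set.mem_iInter.1 hg n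
  let e : G ≃* Multiplicative ZHat := MulEquiv.ofBijective Φ ⟨hinjΦ, hsurj⟩
  have : T2Space (Multiplicative ZHat) := inferInstanceAs (T2Space ZHat)
  exact ⟨{ e with
    continuous_toFun := hcont
    continuous_invFun :=
      (Continuous.homeoOfEquivCompactToT2 (f := e.toEquiv) hcont).symm.continuous }⟩

/-! ### Automorphisms whose fixed field is the base field -/

section Galois

variable {K E : Type*} [Field K] [Field E] [Algebra K E]

/-- Point stabilizers are open in the Krull topology. -/
theorem isLocallyConstant_apply [Algebra.IsIntegral K E] (x : E) :
    IsLocallyConstant fun g : Gal(E/K) => g x := by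
  rw [IsLocallyConstant.iff_eventually_eq]
  intro g
  have h : (MulAction.stabilizer Gal(E/K) x : Set Gal(E/K)) ∈ nhds (1 : Gal(E/K)) :=
    (stabilizer_isOpen_of_isIntegral x).mem_nhds (one_mem _)
  have h2 : Filter.Tendsto (fun y : Gal(E/K) => g⁻¹ * y) (nhds g) (nhds 1) := by
    simpa using (continuous_const_mul g⁻¹).tendsto g
  filter_upwards [h2 h] with y hy
  have hy' : (g⁻¹ * y) x = x := hy
  have := congrArg g hy'
  rwa [← AlgEquiv.mul_apply, mul_inv_cancel_left] at this

/-- The closure of the powers of `φ` has the same fixed field as the whole Galois group. -/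
theorem dense_zpowers_of_fixed [IsGalois K E] (φ : Gal(E/K))
    (hφ : ∀ x, φ x = x → x ∈ Set.range (algebraMap K E)) :
    Dense (Subgroup.zpowers φ : Set Gal(E/K)) := by
  let H : ClosedSubgroup Gal(E/K) :=
    { toSubgroup := (Subgroup.zpowers φ).topologicalClosure
      isClosed' := Subgroup.isClosed_topologicalClosure _ }
  have hbot : IntermediateField.fixedField H.toSubgroup = ⊥ := by
    rw [eq_bot_iff]
    intro x hx
    obtain ⟨y, rfl⟩ := hφ x (hx ⟨φ, Subgroup.le_topologicalClosure _ (Subgroup.mem_zpowers φ)⟩)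
    exact IntermediateField.algebraMap_mem _ _
  have h := InfiniteGalois.fixingSubgroup_fixedField H
  rw [hbot, IntermediateField.fixingSubgroup_bot] at h
  intro g
  have : g ∈ H.toSubgroup := h ▸ Subgroup.mem_top g
  exact this

/-- Density in the Krull topology, in the form used below: on any two elements, every automorphism
agrees with a power of `φ`. -/
theorem exists_zpow_apply_eq [Algebra.IsIntegral K E] {φ : Gal(E/K)}
    (hφ : Dense (Subgroup.zpowers φ : Set Gal(E/K))) (g : Gal(E/K)) (x y : E) :
    ∃ k : ℤ, g x = (φ ^ k) x ∧ g y = (φ ^ k) y := by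
  have hx := (isLocallyConstant_apply (K := K) x).isOpen_fiber (g x)
  have hy := (isLocallyConstant_apply (K := K) y).isOpen_fiber (g y)
  obtain ⟨_, ⟨h1, h2⟩, k, rfl⟩ := hφ.inter_open_nonempty _ (hx.inter hy) ⟨g, rfl, rfl⟩
  exact ⟨k, h1.symm, h2.symm⟩

/-- The powers of `φ` that fix `a` are exactly those whose exponent is a multiple of `n`. -/
def HasExactPeriod (φ : Gal(E/K)) (n : ℕ) (a : E) : Prop :=
  ∀ k : ℤ, (φ ^ k) a = a ↔ (n : ℤ) ∣ k

theorem HasExactPeriod.zpow_apply_eq_iff {φ : Gal(E/K)} {n : ℕ} {a : E}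
    (h : HasExactPeriod φ n a) (k l : ℤ) :
    (φ ^ k) a = (φ ^ l) a ↔ (k : ZMod n) = l := by
  rw [ZMod.intCast_eq_intCast_iff_dvd_sub, ← h, sub_eq_neg_add, zpow_add, zpow_neg,
    AlgEquiv.mul_apply, AlgEquiv.aut_inv, AlgEquiv.symm_apply_eq, eq_comm]

theorem exists_pow_apply_eq_self [Algebra.IsIntegral K E] (φ : Gal(E/K)) (x : E) :
    ∃ n : ℕ+, (φ ^ (n : ℕ)) x = x := by
  classical
  let f : ℕ → (minpoly K x).rootSet E := fun k => ⟨(φ ^ k) x, by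
    rw [Polynomial.mem_rootSet_of_ne (minpoly.ne_zero (Algebra.IsIntegral.isIntegral x)),
      Polynomial.aeval_algHom_apply, minpoly.aeval, map_zero]⟩
  obtain ⟨a, b, hab, h⟩ := Finite.exists_ne_map_eq_of_infinite f
  wlog hlt : a < b generalizing a b
  · exact this b a hab.symm h.symm (by omega)
  refine ⟨⟨b - a, by omega⟩, ?_⟩
  have h' : (φ ^ a) x = (φ ^ b) x := congrArg Subtype.val h
  rw [← Nat.add_sub_cancel' hlt.le, pow_add, AlgEquiv.mul_apply] at h'
  exact ((φ ^ a).injective h').symm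

/-- The character `χ n` reads off, modulo `n`, the exponent of a power of `φ` that agrees with the
given automorphism at the point `a n` of exact period `n`. -/
theorem nonempty_gal_continuousMulEquiv_zHat [IsGalois K E] (φ : Gal(E/K))
    (hφ : ∀ x, φ x = x → x ∈ Set.range (algebraMap K E))
    (a : ℕ+ → E) (ha : ∀ n : ℕ+, HasExactPeriod φ n (a n)) :
    Nonempty (Gal(E/K) ≃ₜ* Multiplicative ZHat) := by
  have hd := dense_zpowers_of_fixed φ hφ
  have hex (n : ℕ+) (y : E) : ∃ c : ZMod n, ∀ k : ℤ, y = (φ ^ k) (a n) → c = k := by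
    by_cases h : ∃ k : ℤ, y = (φ ^ k) (a n)
    · obtain ⟨k, hk⟩ := h
      exact ⟨k, fun l hl => ((ha n).zpow_apply_eq_iff k l).1 (hk.symm.trans hl)⟩
    · exact ⟨0, fun k hk => (h ⟨k, hk⟩).elim⟩
  choose c hc using hex
  let χ (n : ℕ+) : Gal(E/K) →* Multiplicative (ZMod n) :=
    MonoidHom.mk' (fun g => Multiplicative.ofAdd (c n (g (a n)))) fun g h => by
      -- A single power of `φ` computes `g` on both `a n` and `h (a n)`.
      obtain ⟨l, hl, -⟩ := exists_zpow_apply_eq hd h (a n) (a n)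
      obtain ⟨k, hk, hk'⟩ := exists_zpow_apply_eq hd g (a n) ((φ ^ l) (a n))
      have hgh : (g * h) (a n) = (φ ^ (k + l)) (a n) := by
        rw [AlgEquiv.mul_apply, hl, hk', zpow_add, AlgEquiv.mul_apply]
      rw [hc n _ _ hgh, hc n _ _ hl, hc n _ _ hk, Int.cast_add, ofAdd_add]
  refine nonempty_continuousMulEquiv_zHat φ hd χ (fun n => ?_) (fun n => ?_) fun g hg => ?_
  · exact ((isLocallyConstant_apply (a n)).comp
      fun y => Multiplicative.ofAdd (c n y)).continuous
  · have := hc n (φ (a n)) 1 (by rw [zpow_one])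
    rw [Int.cast_one] at this
    exact congrArg Multiplicative.ofAdd this
  · -- If `x` has period `n`, then `g` acts on `x` as a power of `φ` with exponent divisible by `n`.
    ext x
    obtain ⟨n, hn⟩ := exists_pow_apply_eq_self φ x
    obtain ⟨k, hk, hkx⟩ := exists_zpow_apply_eq hd g (a n) x
    have h0 : c n (g (a n)) = 0 := Multiplicative.ofAdd.injective (hg n)
    rw [hc n _ _ hk, ZMod.intCast_zmod_eq_zero_iff_dvd] at h0
    obtain ⟨j, rfl⟩ := h0
    rw [hkx, zpow_mul, zpow_natCast, AlgEquiv.one_apply]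
    have : φ ^ (n : ℕ) ∈ MulAction.stabilizer Gal(E/K) x := hn
    exact Subgroup.zpow_mem _ this j

end Galois

section Descent

variable {K L : Type*} [Field K] [Field L] [Algebra K L]

open Polynomial in
/-- The product of `X - C y` over the orbit of `x` is fixed by `φ`, so it has coefficients in `K`.
-/
theorem isAlgebraic_of_iterate_fixed (φ : L →ₐ[K] L)
    (hφ : ∀ x, φ x = x → x ∈ Set.range (algebraMap K L)) {n : ℕ} (hn : 0 < n) {x : L}
    (hx : φ^[n] x = x) : IsAlgebraic K x := by
  let P : L[X] := ∏ k ∈ Finset.range n, (X - C (φ^[k] x))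
  have hP : P.map (φ : L →+* L) = P := by
    simp only [P, Polynomial.map_prod, Polynomial.map_sub, map_X, map_C]
    have h (k : ℕ) : (φ : L →+* L) (φ^[k] x) = φ^[k + 1] x :=
      (Function.iterate_succ_apply' φ k x).symm
    simp only [h]
    obtain ⟨m, rfl⟩ : ∃ m, n = m + 1 := ⟨n - 1, by omega⟩
    rw [Finset.prod_range_succ, hx, Finset.prod_range_succ', Function.iterate_zero_apply]
  have hl : P ∈ Polynomial.lifts (algebraMap K L) := by
    rw [Polynomial.lifts_iff_coeff_lifts]
    intro i
    apply hφ
    conv_rhs => rw [← hP]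
    rw [coeff_map]
    rfl
  have hmonic : P.Monic := monic_prod_of_monic _ _ fun k _ => monic_X_sub_C _
  obtain ⟨Q, hQ, -, hQm⟩ := lifts_and_natDegree_eq_and_monic hl hmonic
  refine ⟨Q, hQm.ne_zero, ?_⟩
  rw [aeval_def, ← eval_map, hQ, eval_prod]
  exact Finset.prod_eq_zero (Finset.mem_range.2 hn) (by simp)

/-- It suffices to see the automorphism on an algebraically closed extension `L` of `K`, possibly
transcendental: it restricts to the algebraic closure, and its periodic points are algebraic. -/
theorem isQuasiFinite_of_algHom [PerfectField K] [IsAlgClosed L] (φ : L →ₐ[K] L)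
    (hφ : ∀ x, φ x = x → x ∈ Set.range (algebraMap K L))
    (hper : ∀ n : ℕ, 0 < n → ∃ x : L, φ^[n] x = x ∧ ∀ k, 0 < k → k < n → φ^[k] x ≠ x) :
    IsQuasiFinite K := by
  refine ⟨inferInstance, ?_⟩
  let ι : AlgebraicClosure K →ₐ[K] L := IsAlgClosed.lift
  let _ : Algebra (AlgebraicClosure K) L := ι.toRingHom.toAlgebra
  have : IsScalarTower K (AlgebraicClosure K) L :=
    IsScalarTower.of_algebraMap_eq fun x => (ι.commutes x).symm
  let ψ : Gal(AlgebraicClosure K/K) := φ.restrictNormal' (AlgebraicClosure K)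
  have hψ (x : AlgebraicClosure K) :
      algebraMap (AlgebraicClosure K) L (ψ x) = φ (algebraMap (AlgebraicClosure K) L x) :=
    φ.restrictNormal_commutes (AlgebraicClosure K) x
  have hψk (k : ℕ) (x : AlgebraicClosure K) : algebraMap (AlgebraicClosure K) L ((ψ ^ k) x) =
      φ^[k] (algebraMap (AlgebraicClosure K) L x) := by
    induction k with
    | zero => rfl
    | succ k ih => rw [pow_succ', AlgEquiv.mul_apply, hψ, ih, Function.iterate_succ_apply']
  have hinj : Function.Injective (algebraMap (AlgebraicClosure K) L) :=
    (algebraMap (AlgebraicClosure K) L).injective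
  have hfix (x : AlgebraicClosure K) (hx : ψ x = x) :
      x ∈ Set.range (algebraMap K (AlgebraicClosure K)) := by
    obtain ⟨y, hy⟩ := hφ (algebraMap _ L x) (by rw [← hψ, hx])
    refine ⟨y, hinj ?_⟩
    rw [← IsScalarTower.algebraMap_apply, hy]
  have hpt (n : ℕ+) : ∃ a : AlgebraicClosure K, HasExactPeriod ψ n a := by
    obtain ⟨x, hx, hlt⟩ := hper n n.pos
    obtain ⟨a, rfl⟩ : ∃ a, algebraMap (AlgebraicClosure K) L a = x := by
      have halg := isAlgebraic_of_iterate_fixed φ hφ n.pos hx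
      have hint : IsIntegral (AlgebraicClosure K) x := halg.isIntegral.tower_top
      exact minpoly.mem_range_of_degree_eq_one _ x
        (IsAlgClosed.degree_eq_one_of_irreducible _ (minpoly.irreducible hint))
    simp only [← hψk, ne_eq, hinj.eq_iff] at hx hlt
    have hmul (q : ℤ) : (ψ ^ ((n : ℤ) * q)) a = a := by
      have : ψ ^ (n : ℕ) ∈ MulAction.stabilizer Gal(AlgebraicClosure K/K) a := hx
      rw [zpow_mul, zpow_natCast]
      exact Subgroup.zpow_mem _ this q
    refine ⟨a, fun k => ⟨fun hk => ?_, fun ⟨q, hq⟩ => hq ▸ hmul q⟩⟩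
    by_contra hdvd
    have hn : (0 : ℤ) < n := mod_cast n.pos
    have h0 := Int.emod_nonneg k hn.ne'
    have h1 := Int.emod_lt_of_pos k hn
    have h2 : k % n ≠ 0 := fun h => hdvd (Int.dvd_of_emod_eq_zero h)
    refine hlt (k % n).toNat (by omega) (by omega) ?_
    rw [← zpow_natCast, Int.toNat_of_nonneg h0]
    rw [← Int.emod_add_mul_ediv k n, zpow_add, AlgEquiv.mul_apply, hmul] at hk
    exact hk
  choose a ha using hpt
  exact nonempty_gal_continuousMulEquiv_zHat ψ hfix a ha

end Descent

/-! ### Ultraproducts of fields -/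

section Ultraproduct

variable {ι : Type*} (U : Ultrafilter ι) (F : ι → Type*) [∀ i, Field (F i)]

/-- The families that vanish `U`-almost everywhere. -/
def ultraIdeal : Ideal (∀ i, F i) where
  carrier := {f | ∀ᶠ i in (U : Filter ι), f i = 0}
  zero_mem' := by simp
  add_mem' := by
    intro f g hf hg
    filter_upwards [hf, hg] with i h1 h2
    rw [Pi.add_apply, h1, h2, add_zero]
  smul_mem' := by
    intro c f hf
    filter_upwards [hf] with i h
    rw [smul_eq_mul, Pi.mul_apply, h, mul_zero]

/-- The ultraproduct of the fields `F i` along `U`. -/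
abbrev Ultraproduct : Type _ := (∀ i, F i) ⧸ ultraIdeal U F

variable {F}

theorem ultraproduct_mk_eq_iff (f g : ∀ i, F i) :
    (Ideal.Quotient.mk (ultraIdeal U F) f = Ideal.Quotient.mk (ultraIdeal U F) g) ↔
      ∀ᶠ i in (U : Filter ι), f i = g i := by
  rw [Ideal.Quotient.eq]
  change (∀ᶠ i in (U : Filter ι), f i - g i = 0) ↔ _
  simp only [sub_eq_zero]

variable (F)

theorem ultraIdeal_isMaximal : (ultraIdeal U F).IsMaximal := by
  refine Ideal.Quotient.maximal_of_isField _ ⟨⟨0, 1, ?_⟩, mul_comm, ?_⟩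
  · intro h
    rw [← map_zero (Ideal.Quotient.mk _), ← map_one (Ideal.Quotient.mk _),
      ultraproduct_mk_eq_iff] at h
    obtain ⟨i, hi⟩ := h.exists
    exact zero_ne_one hi
  · intro x hx
    obtain ⟨f, rfl⟩ := Ideal.Quotient.mk_surjective x
    rw [ne_eq, ← map_zero (Ideal.Quotient.mk _), ultraproduct_mk_eq_iff,
      ← Ultrafilter.eventually_not] at hx
    refine ⟨Ideal.Quotient.mk _ fun i => (f i)⁻¹, ?_⟩
    rw [← map_mul, ← map_one (Ideal.Quotient.mk _), ultraproduct_mk_eq_iff]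
    filter_upwards [hx] with i hi
    exact mul_inv_cancel₀ hi

noncomputable instance : Field (Ultraproduct U F) :=
  haveI := ultraIdeal_isMaximal U F
  Ideal.Quotient.field _

/-- A monic polynomial over the ultraproduct lifts to a family of monic polynomials of the same
degree; roots of these, one for each index, make up a root. -/
theorem isAlgClosed_ultraproduct [∀ i, IsAlgClosed (F i)] : IsAlgClosed (Ultraproduct U F) := by
  refine IsAlgClosed.of_exists_root _ fun P hP hirr => ?_
  have hl : P ∈ Polynomial.lifts (Ideal.Quotient.mk (ultraIdeal U F)) :=
    (Polynomial.lifts_iff_coeff_lifts _).2 fun n => Ideal.Quotient.mk_surjective _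
  obtain ⟨Q, rfl, hdeg, hQ⟩ := Polynomial.lifts_and_natDegree_eq_and_monic hl hP
  have hroot (i : ι) : ∃ x : F i, (Q.map (Pi.evalRingHom F i)).IsRoot x := by
    refine IsAlgClosed.exists_root _ fun h0 => ?_
    have h1 := Polynomial.degree_pos_of_irreducible hirr
    rw [hQ.degree_map] at h0 h1
    exact h1.ne' h0
  choose x hx using hroot
  refine ⟨Ideal.Quotient.mk _ x, ?_⟩
  rw [Polynomial.eval_map_apply]
  have : Q.eval x = 0 := by
    funext i
    have := hx i
    rw [Polynomial.IsRoot.def, Polynomial.eval_map] at this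
    exact (Polynomial.eval₂_at_apply (Pi.evalRingHom F i) x).symm.trans this
  rw [this, map_zero]

/-- The endomorphism induced on an ultraproduct by endomorphisms of the factors. -/
def ultraproductMap (σ : ∀ i, F i →+* F i) : Ultraproduct U F →+* Ultraproduct U F :=
  Ideal.quotientMap _ (RingHom.pi fun i => (σ i).comp (Pi.evalRingHom F i)) fun f hf => by
    filter_upwards [hf] with i hi
    exact (congrArg (σ i) hi).trans (map_zero _)

theorem ultraproductMap_iterate_mk (σ : ∀ i, F i →+* F i) (k : ℕ) (f : ∀ i, F i) :
    (ultraproductMap U F σ)^[k] (Ideal.Quotient.mk (ultraIdeal U F) f) =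
      Ideal.Quotient.mk (ultraIdeal U F) fun i => (σ i)^[k] (f i) := by
  induction k with
  | zero => rfl
  | succ k ih =>
    rw [Function.iterate_succ_apply', ih]
    simp only [Function.iterate_succ_apply']
    rfl

end Ultraproduct

/-! ### Prime ideals of `𝒜` and non-principal ultrafilters -/

instance factPrime (p : Nat.Primes) : Fact (p : ℕ).Prime := ⟨p.2⟩

theorem toA_surjective : Function.Surjective toA := Ideal.Quotient.mk_surjective

theorem toA_eq_zero_iff (f : ∀ p : Nat.Primes, ZMod p) : toA f = 0 ↔ {p | f p ≠ 0}.Finite :=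
  Ideal.Quotient.eq_zero_iff_mem

theorem toA_mem_of_zeros_subset (m : Ideal A) {f g : ∀ p : Nat.Primes, ZMod p} (hf : toA f ∈ m)
    (h : ∀ p, f p = 0 → g p = 0) : toA g ∈ m := by
  have : g = g * f⁻¹ * f := by
    funext p
    by_cases hp : f p = 0
    · simp [hp, h p hp]
    · simp [hp]
  rw [this, map_mul]
  exact m.mul_mem_left _ hf

open Classical in
/-- The idempotent of `∏_p 𝔽_p` that is `1` off `S` and `0` on `S`. -/
noncomputable def offIndicator (S : Set Nat.Primes) : ∀ p : Nat.Primes, ZMod p :=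
  fun p => if p ∈ S then 0 else 1

theorem offIndicator_eq_zero_iff {S : Set Nat.Primes} {p : Nat.Primes} :
    offIndicator S p = 0 ↔ p ∈ S := by
  simp [offIndicator]

/-- The zero sets of the families whose class lies in the prime ideal `m`. -/
noncomputable def zeroUltrafilter (m : Ideal A) [hm : m.IsPrime] : Ultrafilter Nat.Primes :=
  Ultrafilter.ofComplNotMemIff
    { sets := {S | toA (offIndicator S) ∈ m}
      univ_sets := by
        have : offIndicator Set.univ = 0 := funext fun p => by simp [offIndicator]
        simp [this]
      sets_of_superset := fun {S T} hS hST => toA_mem_of_zeros_subset m hS fun p => by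
        simpa only [offIndicator_eq_zero_iff] using fun h => hST h
      inter_sets := fun {S T} hS hT => by
        have : offIndicator (S ∩ T) = offIndicator S +
            (1 - offIndicator S) * offIndicator T := funext fun p => by
          by_cases h1 : p ∈ S <;> by_cases h2 : p ∈ T <;> simp [offIndicator, h1, h2]
        simp only [Set.mem_ofPred_eq, this, map_add, map_mul]
        exact m.add_mem hS (m.mul_mem_left _ hT) }
    fun S => by
      change toA (offIndicator Sᶜ) ∉ m ↔ toA (offIndicator S) ∈ m
      have hmul : offIndicator Sᶜ * offIndicator S = 0 := funext fun p => by
        by_cases h : p ∈ S <;> simp [offIndicator, h]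
      have hadd : offIndicator Sᶜ + offIndicator S = 1 := funext fun p => by
        by_cases h : p ∈ S <;> simp [offIndicator, h]
      constructor
      · intro h
        refine (hm.mem_or_mem ?_).resolve_left h
        rw [← map_mul, hmul, map_zero]
        exact m.zero_mem
      · intro h1 h2
        refine hm.ne_top ((Ideal.eq_top_iff_one m).2 ?_)
        rw [← map_one toA, ← hadd, map_add]
        exact m.add_mem h2 h1

theorem corresponds_zeroUltrafilter (m : Ideal A) [hm : m.IsPrime] :
    Corresponds m (zeroUltrafilter m) := by
  have hmem (S : Set Nat.Primes) : S ∈ zeroUltrafilter m ↔ toA (offIndicator S) ∈ m := Iff.rfl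
  refine ⟨fun p hp => ?_, fun f => ?_⟩
  · have h : ({p}ᶜ : Set Nat.Primes) ∈ zeroUltrafilter m := by
      have h0 : toA (offIndicator {p}ᶜ) = 0 := by
        rw [toA_eq_zero_iff]
        refine (Set.finite_singleton p).subset fun q hq => ?_
        simpa [offIndicator_eq_zero_iff] using hq
      rw [hmem, h0]
      exact m.zero_mem
    rw [hp] at h
    -- `{p}ᶜ ∈ pure p` unfolds to `p ∈ {p}ᶜ`.
    exact h rfl
  · change _ ↔ {p | f p = 0} ∈ zeroUltrafilter m
    rw [hmem]
    constructor <;> intro h <;> refine toA_mem_of_zeros_subset m h fun p => ?_ <;>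
      simp [offIndicator_eq_zero_iff]

theorem Corresponds.unique {m : Ideal A} {U V : Ultrafilter Nat.Primes} (hU : Corresponds m U)
    (hV : Corresponds m V) : U = V := by
  ext S
  have h1 := hU.2 (offIndicator S)
  have h2 := hV.2 (offIndicator S)
  simp only [offIndicator_eq_zero_iff] at h1 h2
  exact h1.symm.trans h2

theorem Corresponds.le_cofinite {m : Ideal A} {U : Ultrafilter Nat.Primes}
    (hU : Corresponds m U) : (U : Filter Nat.Primes) ≤ Filter.cofinite := by
  refine U.le_cofinite_or_eq_pure.resolve_right ?_
  rintro ⟨p, hp⟩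
  exact hU.1 p hp

/-- The class of a family in `𝒜/m`. -/
def residueClass (m : Ideal A) : (∀ p : Nat.Primes, ZMod p) →+* A ⧸ m :=
  (Ideal.Quotient.mk m).comp toA

theorem residueClass_surjective (m : Ideal A) : Function.Surjective (residueClass m) :=
  Ideal.Quotient.mk_surjective.comp toA_surjective

section Residue

variable {m : Ideal A} {U : Ultrafilter Nat.Primes}

theorem Corresponds.residueClass_eq_iff (hU : Corresponds m U) (f g : ∀ p : Nat.Primes, ZMod p) :
    residueClass m f = residueClass m g ↔ ∀ᶠ p in (U : Filter Nat.Primes), f p = g p := by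
  rw [← sub_eq_zero, ← map_sub]
  refine (Ideal.Quotient.eq_zero_iff_mem.trans (hU.2 _)).trans ?_
  simp only [Pi.sub_apply, sub_eq_zero]

/-- `𝒜` is von Neumann regular, so its prime ideals are maximal. -/
theorem isMaximal_of_isPrime (m : Ideal A) [m.IsPrime] : m.IsMaximal := by
  refine Ideal.Quotient.maximal_of_isField _ ⟨⟨0, 1, zero_ne_one⟩, mul_comm, fun {x} hx => ?_⟩
  obtain ⟨f, rfl⟩ := residueClass_surjective m x
  refine ⟨residueClass m f⁻¹, mul_left_cancel₀ hx ?_⟩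
  rw [mul_one, ← map_mul, ← map_mul]
  congr 1
  funext p
  by_cases h : f p = 0 <;> simp [h]

/-- A fixed nonzero integer vanishes modulo only finitely many primes. -/
theorem Corresponds.charZero (hU : Corresponds m U) : CharZero (A ⧸ m) := by
  refine charZero_of_inj_zero fun n hn => ?_
  by_contra h0
  rw [← map_natCast (residueClass m), ← map_zero (residueClass m), hU.residueClass_eq_iff] at hn
  have hfin : {p : Nat.Primes | (p : ℕ) ∣ n}.Finite := by
    refine Set.Finite.of_finite_image ((Set.finite_le_nat n).subset ?_)
      (Subtype.val_injective.injOn)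
    rintro _ ⟨p, hp, rfl⟩
    exact Nat.le_of_dvd (Nat.pos_of_ne_zero h0) hp
  obtain ⟨p, hp, hp'⟩ := (hn.and (hU.le_cofinite hfin.compl_mem_cofinite)).exists
  exact hp' ((ZMod.natCast_eq_zero_iff n p).1 hp)

end Residue

/-! ### The residue fields are quasi-finite -/

theorem iterate_frobenius_eq_pow (p : ℕ) [Fact p.Prime] (R : Type*) [CommRing R] [CharP R p]
    (k : ℕ) (x : R) : (frobenius R p)^[k] x = x ^ p ^ k := by
  rw [← coe_iterateFrobenius, iterateFrobenius_def]

/-- A primitive `(p ^ n - 1)`-th root of unity has degree `n` over `𝔽_p`. -/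
theorem exists_frobenius_period (p : ℕ) [Fact p.Prime] (F : Type*) [Field F] [IsAlgClosed F]
    [CharP F p] {n : ℕ} (hn : 0 < n) :
    ∃ x : F, (frobenius F p)^[n] x = x ∧ ∀ k, 0 < k → k < n → (frobenius F p)^[k] x ≠ x := by
  have hp : 1 < p := (Fact.out : p.Prime).one_lt
  have hpow {k : ℕ} (hk : 0 < k) : 1 < p ^ k := Nat.one_lt_pow hk.ne' hp
  have : NeZero ((p ^ n - 1 : ℕ) : F) := ⟨by
    rw [Nat.cast_sub (hpow hn).le, Nat.cast_pow, CharP.cast_eq_zero, zero_pow hn.ne']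
    simp⟩
  obtain ⟨x, hx⟩ := HasEnoughRootsOfUnity.exists_primitiveRoot F (p ^ n - 1)
  have hx0 : x ≠ 0 := hx.ne_zero (by have := hpow hn; omega)
  have key {k : ℕ} (hk : 0 < k) : (frobenius F p)^[k] x = x ↔ p ^ n - 1 ∣ p ^ k - 1 := by
    rw [iterate_frobenius_eq_pow, ← hx.pow_eq_one_iff_dvd]
    have : x ^ p ^ k = x ^ (p ^ k - 1) * x := by
      rw [← pow_succ, Nat.sub_add_cancel (hpow hk).le]
    rw [this, mul_eq_right₀ hx0]
  refine ⟨x, (key hn).2 dvd_rfl, fun k hk hkn h => ?_⟩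
  have h1 := Nat.le_of_dvd (Nat.sub_pos_of_lt (hpow hk)) ((key hk).1 h)
  have h2 := Nat.pow_lt_pow_right hp hkn
  have h3 := hpow hk
  omega

section QuasiFinite

variable {m : Ideal A} {U : Ultrafilter Nat.Primes}

/-- The closures `𝔽̄_p` of the prime fields. -/
abbrev PrimeClosure (p : Nat.Primes) : Type := AlgebraicClosure (ZMod p)

/-- The inclusions `𝔽_p → 𝔽̄_p` induce an embedding of `𝒜/m` into the ultraproduct. -/
theorem Corresponds.exists_embedding (hU : Corresponds m U) :
    ∃ j : A ⧸ m →+* Ultraproduct U PrimeClosure, ∀ f : ∀ p : Nat.Primes, ZMod p,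
      j (residueClass m f) =
        Ideal.Quotient.mk _ fun p : Nat.Primes => algebraMap (ZMod p) (PrimeClosure p) (f p) := by
  let g : (∀ p : Nat.Primes, ZMod p) →+* Ultraproduct U PrimeClosure :=
    (Ideal.Quotient.mk _).comp
      (RingHom.pi fun p => (algebraMap (ZMod p) (PrimeClosure p)).comp (Pi.evalRingHom _ p))
  have hg : RingHom.ker (residueClass m) ≤ RingHom.ker g := by
    intro f hf
    rw [RingHom.mem_ker, ← map_zero (residueClass m), hU.residueClass_eq_iff] at hf
    rw [RingHom.mem_ker, ← map_zero (Ideal.Quotient.mk _)]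
    refine (ultraproduct_mk_eq_iff U _ _).2 ?_
    filter_upwards [hf] with p hp
    exact (congrArg (algebraMap (ZMod p) (PrimeClosure p)) hp).trans (map_zero _)
  exact ⟨RingHom.liftOfSurjective (residueClass m) (residueClass_surjective m) ⟨g, hg⟩,
    fun f => RingHom.liftOfRightInverse_comp_apply _ _ _ ⟨g, hg⟩ f⟩

/-- The ultraproduct of the `𝔽̄_p` is an algebraically closed extension of `𝒜/m`, and on it the
ultraproduct of the Frobenius maps has fixed field `𝒜/m` and points of every exact period. -/
theorem Corresponds.isQuasiFinite [m.IsMaximal] (hU : Corresponds m U) :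
    @IsQuasiFinite (A ⧸ m) (Ideal.Quotient.field m) := by
  let _ : Field (A ⧸ m) := Ideal.Quotient.field m
  have _ : CharZero (A ⧸ m) := hU.charZero
  have _ := isAlgClosed_ultraproduct U PrimeClosure
  obtain ⟨j, hj⟩ := hU.exists_embedding
  let _ : Algebra (A ⧸ m) (Ultraproduct U PrimeClosure) := j.toAlgebra
  let σ (p : Nat.Primes) : PrimeClosure p →+* PrimeClosure p := frobenius (PrimeClosure p) p
  let φ : Ultraproduct U PrimeClosure →ₐ[A ⧸ m] Ultraproduct U PrimeClosure :=
    { ultraproductMap U PrimeClosure σ with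
      commutes' := fun x => by
        obtain ⟨f, rfl⟩ := residueClass_surjective m x
        change ultraproductMap U PrimeClosure σ (j _) = j _
        rw [hj]
        refine (ultraproductMap_iterate_mk U PrimeClosure σ 1 _).trans ?_
        congr 1
        funext p
        change (algebraMap (ZMod p) (PrimeClosure p) (f p)) ^ (p : ℕ) = _
        rw [← map_pow, ZMod.pow_card] }
  have hφ (k : ℕ) (a : ∀ p, PrimeClosure p) : φ^[k] (Ideal.Quotient.mk _ a) =
      Ideal.Quotient.mk _ fun p => (σ p)^[k] (a p) :=
    ultraproductMap_iterate_mk U PrimeClosure σ k a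
  refine isQuasiFinite_of_algHom φ (fun x hx => ?_) fun n hn => ?_
  · obtain ⟨a, rfl⟩ := Ideal.Quotient.mk_surjective x
    have hx' := ((hφ 1 a).symm.trans hx)
    rw [ultraproduct_mk_eq_iff] at hx'
    have hbase (p : Nat.Primes) : ∃ b : ZMod p, σ p (a p) = a p → algebraMap _ _ b = a p := by
      by_cases h : σ p (a p) = a p
      · have h1 := (Subfield.mem_bot_iff_pow_eq_self (PrimeClosure p) p).2 h
        obtain ⟨z, hz⟩ := (mem_bot_iff_intCast p (PrimeClosure p)).1 h1
        exact ⟨z, fun _ => by rw [map_intCast, hz]⟩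
      · exact ⟨0, fun h' => (h h').elim⟩
    choose b hb using hbase
    refine ⟨residueClass m b, (hj b).trans ?_⟩
    rw [ultraproduct_mk_eq_iff]
    filter_upwards [hx'] with p hp
    exact hb p hp
  · choose a ha hlt using fun p : Nat.Primes => exists_frobenius_period p (PrimeClosure p) hn
    refine ⟨Ideal.Quotient.mk _ a, ?_, fun k hk hkn h => ?_⟩
    · rw [hφ]
      congr 1
      exact funext ha
    · rw [hφ, ultraproduct_mk_eq_iff] at h
      obtain ⟨p, hp⟩ := h.exists
      exact hlt p k hk hkn hp

end QuasiFinite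

/-! ### The unit group -/

section Units

variable {m : Ideal A} {U : Ultrafilter Nat.Primes}

theorem unitClass_mul (f g : ∀ p : Nat.Primes, (ZMod p)ˣ) :
    unitClass m (f * g) = unitClass m f * unitClass m g := by
  simp only [unitClass, map_mul]

theorem unitClass_one : unitClass m 1 = 1 := by
  simp only [unitClass, map_one]

theorem val_unitClass (f : ∀ p : Nat.Primes, (ZMod p)ˣ) :
    (unitClass m f : A ⧸ m) = residueClass m fun p => (f p : ZMod p) := rfl

theorem Corresponds.unitClass_eq_iff (hU : Corresponds m U) (f g : ∀ p : Nat.Primes, (ZMod p)ˣ) :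
    unitClass m f = unitClass m g ↔ ∀ᶠ p in (U : Filter Nat.Primes), f p = g p := by
  simp only [Units.ext_iff, val_unitClass, hU.residueClass_eq_iff]

theorem Corresponds.unitClass_surjective (hU : Corresponds m U) [m.IsPrime] :
    Function.Surjective (unitClass m) := by
  classical
  intro u
  obtain ⟨g, hg⟩ := residueClass_surjective m u
  have hne : ∀ᶠ p in (U : Filter Nat.Primes), g p ≠ 0 := by
    rw [Ultrafilter.eventually_not]
    intro h
    exact u.ne_zero (hg.symm.trans (((hU.residueClass_eq_iff g 0).2 h).trans (map_zero _)))
  refine ⟨fun p => if h : g p ≠ 0 then Units.mk0 (g p) h else 1, Units.ext ?_⟩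
  rw [val_unitClass, ← hg, hU.residueClass_eq_iff]
  filter_upwards [hne] with p hp
  rw [dif_pos hp, Units.val_mk0]

/-- Entrywise exponentiation of representatives respects equality `U`-almost everywhere on both
sides, so it descends; every class has a representative, so it is determined. -/
theorem Corresponds.existsUnique_isNaturalModule (hU : Corresponds m U) [m.IsPrime] :
    ∃! M : Module (NonstandardInt U) (Additive (A ⧸ m)ˣ), IsNaturalModule m U M := by
  choose s hs using hU.unitClass_surjective
  choose r hr using fun n : NonstandardInt U =>
    (n.inductionOn fun f => ⟨f, rfl⟩ : ∃ f : Nat.Primes → ℤ, (f : NonstandardInt U) = n)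
  let sm (n : NonstandardInt U) (x : Additive (A ⧸ m)ˣ) : Additive (A ⧸ m)ˣ :=
    Additive.ofMul (unitClass m fun p => s x.toMul p ^ r n p)
  have hsm (n : Nat.Primes → ℤ) (f : ∀ p : Nat.Primes, (ZMod p)ˣ) :
      sm n (Additive.ofMul (unitClass m f)) =
        Additive.ofMul (unitClass m fun p => f p ^ n p) := by
    refine congrArg Additive.ofMul ((hU.unitClass_eq_iff _ _).2 ?_)
    filter_upwards [(hU.unitClass_eq_iff _ _).1 (hs (unitClass m f)),
      Filter.Germ.coe_eq.1 (hr n)] with p h1 h2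
    rw [h2, toMul_ofMul, h1]
  have hrepr (x : Additive (A ⧸ m)ˣ) : ∃ f, Additive.ofMul (unitClass m f) = x := ⟨s x.toMul, hs _⟩
  let M : Module (NonstandardInt U) (Additive (A ⧸ m)ˣ) :=
    { smul := sm
      one_smul := fun x => by
        obtain ⟨f, rfl⟩ := hrepr x
        refine (hsm 1 f).trans ?_
        simp
      mul_smul := fun n k x => by
        obtain ⟨f, rfl⟩ := hrepr x
        induction n using Filter.Germ.inductionOn with | _ n => ?_
        induction k using Filter.Germ.inductionOn with | _ k => ?_
        refine (hsm (n * k) f).trans (Eq.symm ((congrArg (sm n) (hsm k f)).trans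
          ((hsm n _).trans ?_)))
        simp only [← zpow_mul, Pi.mul_apply, mul_comm]
      smul_zero := fun n => by
        induction n using Filter.Germ.inductionOn with | _ n => ?_
        have h0 : (0 : Additive (A ⧸ m)ˣ) = Additive.ofMul (unitClass m 1) := by
          rw [unitClass_one, ofMul_one]
        rw [h0]
        refine (hsm n 1).trans ?_
        simp only [Pi.one_apply, one_zpow]
        rfl
      smul_add := fun n x y => by
        obtain ⟨f, rfl⟩ := hrepr x
        obtain ⟨g, rfl⟩ := hrepr y
        induction n using Filter.Germ.inductionOn with | _ n => ?_
        rw [← ofMul_mul, ← unitClass_mul]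
        refine (hsm n _).trans (Eq.symm ((congrArg₂ (· + ·) (hsm n f) (hsm n g)).trans ?_))
        rw [← ofMul_mul, ← unitClass_mul]
        simp only [Pi.mul_apply, mul_zpow]
        rfl
      add_smul := fun n k x => by
        obtain ⟨f, rfl⟩ := hrepr x
        induction n using Filter.Germ.inductionOn with | _ n => ?_
        induction k using Filter.Germ.inductionOn with | _ k => ?_
        refine (hsm (n + k) f).trans (Eq.symm ((congrArg₂ (· + ·) (hsm n f) (hsm k f)).trans ?_))
        rw [← ofMul_mul, ← unitClass_mul]
        simp only [Pi.add_apply, zpow_add]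
        rfl
      zero_smul := fun x => by
        obtain ⟨f, rfl⟩ := hrepr x
        refine (hsm 0 f).trans ?_
        simp only [Pi.zero_apply, zpow_zero]
        exact congrArg Additive.ofMul unitClass_one }
  refine ⟨M, hsm, fun N hN => Module.ext' _ _ fun n x => ?_⟩
  obtain ⟨f, rfl⟩ := hrepr x
  induction n using Filter.Germ.inductionOn with | _ n => ?_
  exact (hN n f).trans (hsm n f).symm

theorem isSquare_mul_of_not_isSquare {F : Type*} [Field F] [Finite F] {a b : Fˣ}
    (ha : ¬IsSquare a) (hb : ¬IsSquare b) : IsSquare (a * b) := by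
  classical
  have := Fintype.ofFinite F
  have hval (c : Fˣ) : IsSquare (c : F) ↔ IsSquare c := by
    refine ⟨fun ⟨x, hx⟩ => ?_, fun h => h.map (Units.coeHom F)⟩
    have hx0 : x ≠ 0 := fun h => c.ne_zero (by rw [hx, h, zero_mul])
    exact ⟨Units.mk0 x hx0, Units.ext hx⟩
  rw [← hval, ← quadraticChar_neg_one_iff_not_isSquare] at ha hb
  rw [← hval, ← quadraticChar_one_iff_isSquare (a * b).ne_zero, Units.val_mul, map_mul, ha, hb]
  rfl

/-- A class of units is a square if and only if `U`-almost all entries are, and for odd `p` the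
squares have index two in `𝔽_pˣ`. -/
theorem Corresponds.nonempty_unitsQuotientSquares (hU : Corresponds m U) [m.IsPrime] :
    Nonempty ((A ⧸ m)ˣ ⧸ (powMonoidHom 2 : (A ⧸ m)ˣ →* (A ⧸ m)ˣ).range ≃*
      Multiplicative (ZMod 2)) := by
  have hsq (f : ∀ p : Nat.Primes, (ZMod p)ˣ) :
      unitClass m f ∈ (powMonoidHom 2 : (A ⧸ m)ˣ →* (A ⧸ m)ˣ).range ↔
        ∀ᶠ p in (U : Filter Nat.Primes), IsSquare (f p) := by
    constructor
    · rintro ⟨v, hv⟩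
      obtain ⟨g, rfl⟩ := hU.unitClass_surjective v
      rw [powMonoidHom_apply, pow_two, ← unitClass_mul, hU.unitClass_eq_iff] at hv
      filter_upwards [hv] with p hp
      exact ⟨g p, hp.symm⟩
    · intro h
      have hroot (p : Nat.Primes) : ∃ g : (ZMod p)ˣ, IsSquare (f p) → f p = g * g := by
        by_cases h : IsSquare (f p)
        · exact h.imp fun g hg _ => hg
        · exact ⟨1, fun h' => (h h').elim⟩
      choose g hg using hroot
      refine ⟨unitClass m g, ?_⟩
      rw [powMonoidHom_apply, pow_two, ← unitClass_mul, hU.unitClass_eq_iff]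
      filter_upwards [h] with p hp
      exact (hg p hp).symm
  have hodd : ∀ᶠ p : Nat.Primes in (U : Filter Nat.Primes), (p : ℕ) ≠ 2 := by
    refine hU.le_cofinite (Filter.mem_of_superset
      (Set.finite_singleton (⟨2, Nat.prime_two⟩ : Nat.Primes)).compl_mem_cofinite ?_)
    exact fun p hp h => hp (Subtype.ext h)
  have hns (p : Nat.Primes) : ∃ a : (ZMod p)ˣ, (p : ℕ) ≠ 2 → ¬IsSquare a := by
    by_cases h : (p : ℕ) = 2
    · exact ⟨1, fun h' => (h' h).elim⟩
    · obtain ⟨a, ha⟩ := FiniteField.exists_nonsquare (F := ZMod p) (by rwa [ZMod.ringChar_zmod_n])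
      have ha0 : a ≠ 0 := fun h0 => ha (h0 ▸ IsSquare.zero)
      exact ⟨Units.mk0 a ha0, fun _ hsq => ha (hsq.map (Units.coeHom (ZMod p)))⟩
  choose a ha using hns
  have hindex : (powMonoidHom 2 : (A ⧸ m)ˣ →* (A ⧸ m)ˣ).range.index = 2 := by
    rw [Subgroup.index_eq_two_iff]
    refine ⟨unitClass m a, fun b => ?_⟩
    obtain ⟨f, rfl⟩ := hU.unitClass_surjective b
    rw [← unitClass_mul, hsq, hsq]
    by_cases hf : ∀ᶠ p in (U : Filter Nat.Primes), IsSquare (f p)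
    · refine Or.inr ⟨hf, fun h => ?_⟩
      obtain ⟨p, h1, h2, h3⟩ := (hf.and (h.and hodd)).exists
      exact ha p h3 (by simpa using h1.inv.mul h2)
    · refine Or.inl ⟨?_, hf⟩
      filter_upwards [Ultrafilter.eventually_not.2 hf, hodd] with p h1 h2
      exact isSquare_mul_of_not_isSquare h1 (ha p h2)
  have : Fact (Nat.Prime 2) := ⟨Nat.prime_two⟩
  exact ⟨mulEquivOfPrimeCardEq (p := 2) hindex (by simp)⟩

end Units

/-! ### Embedding into the complex numbers -/

open Cardinal in
/-- Adjoining continuum many variables to `K` and passing to the algebraic closure gives an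
algebraically closed field of characteristic zero and cardinality `𝔠`, hence a copy of `ℂ`. -/
theorem exists_ringHom_complex {K : Type} [Field K] [CharZero K] (hK : #K ≤ 𝔠) :
    Nonempty (K →+* ℂ) := by
  let R := MvPolynomial ℝ K
  let L := AlgebraicClosure (FractionRing R)
  have hR : #R ≤ 𝔠 := by
    refine MvPolynomial.cardinalMk_le_max.trans ?_
    simp [hK, mk_real, aleph0_le_continuum]
  have hL : #L ≤ 𝔠 := by
    refine (Algebra.IsAlgebraic.cardinalMk_le_max (FractionRing R) L).trans
      (max_le ((IsLocalization.cardinalMk_le (nonZeroDivisors R)).trans hR) aleph0_le_continuum)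
  have hL' : 𝔠 ≤ #L := by
    rw [← mk_real]
    exact mk_le_of_injective
      (f := fun x : ℝ => algebraMap (FractionRing R) L (algebraMap R _ (MvPolynomial.X x)))
      (((algebraMap (FractionRing R) L).injective.comp
        (IsFractionRing.injective R (FractionRing R))).comp MvPolynomial.X_injective)
  have heq : #L = #ℂ := by rw [Cardinal.mk_complex, le_antisymm hL hL']
  have : CharZero L := charZero_of_injective_algebraMap (algebraMap K L).injective
  obtain ⟨e⟩ := IsAlgClosed.ringEquiv_of_equiv_of_charZero (K := L) (L := ℂ)
    (by rw [heq, mk_complex]; exact aleph0_lt_continuum) (Cardinal.eq.1 heq)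
  exact ⟨(e : L →+* ℂ).comp (algebraMap K L)⟩

open Cardinal in
/-- `𝒜/m` is a quotient of a countable product of finite sets. -/
theorem mk_quotient_le (m : Ideal A) : #(A ⧸ m) ≤ 𝔠 := by
  refine (mk_le_of_surjective (residueClass_surjective m)).trans ?_
  rw [mk_pi]
  refine (prod_le_prod _ (fun _ => ℵ₀) fun p => mk_le_aleph0).trans ?_
  simp

end FieldBoundary

theorem mainTheorem3 (m : PrimeSpectrum FieldBoundary.A) :
    (∃ _ : m.asIdeal.IsMaximal,
      @FieldBoundary.IsQuasiFinite (FieldBoundary.A ⧸ m.asIdeal) (Ideal.Quotient.field m.asIdeal)) ∧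
    (∃! U : Ultrafilter Nat.Primes, FieldBoundary.Corresponds m.asIdeal U) ∧
    (∀ U : Ultrafilter Nat.Primes, FieldBoundary.Corresponds m.asIdeal U →
      ∃! M : Module (FieldBoundary.NonstandardInt U) (Additive (FieldBoundary.A ⧸ m.asIdeal)ˣ),
        FieldBoundary.IsNaturalModule m.asIdeal U M) ∧
    Nonempty ((FieldBoundary.A ⧸ m.asIdeal)ˣ ⧸
        (powMonoidHom 2 : (FieldBoundary.A ⧸ m.asIdeal)ˣ →* (FieldBoundary.A ⧸ m.asIdeal)ˣ).range
      ≃* Multiplicative (ZMod 2)) ∧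
    (∃ L : Subfield ℂ, Nonempty (FieldBoundary.A ⧸ m.asIdeal ≃+* L)) := by
  have hU := FieldBoundary.corresponds_zeroUltrafilter m.asIdeal
  have hmax := FieldBoundary.isMaximal_of_isPrime m.asIdeal
  refine ⟨⟨hmax, hU.isQuasiFinite⟩, ⟨_, hU, fun V hV => hV.unique hU⟩,
    fun V hV => hV.existsUnique_isNaturalModule, hU.nonempty_unitsQuotientSquares, ?_⟩
  let _ := Ideal.Quotient.field m.asIdeal
  have _ := hU.charZero
  obtain ⟨i⟩ := FieldBoundary.exists_ringHom_complex (FieldBoundary.mk_quotient_le m.asIdeal)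
  exact ⟨i.fieldRange, ⟨RingEquiv.ofBijective i.rangeRestrictField
    (RingHom.rangeRestrictField_bijective i)⟩⟩
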